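/- Let $G$ be a second-countable locally compact (Hausdorff) group with left Haar measure $dx$, let $\mathcal H$ be a separable complex Hilbert space, and let $\pi\colon G\to U(\mathcal H)$ be a strongly continuous unitary representation. Let $\{u_i\}_{i\in I}$ be a countable family in $\mathcal H$ whose orbit system $E=\{\pi(x)u_i\}_{x\in G,\,i\in I}$ is complete, i.e. $\overline{\operatorname{span}}\{\pi(x)u_i : x\in G,\ i\in I\}=\mathcal H$, and Bessel, i.e. there is $B>0$ with $$\sum_{i\in I}\int_G|\langle v,\pi(x)u_i\rangle|^2\,dx\le B\|v\|^2\qquad\text{for all } v\in\mathcal H$$ (so that $\pi$ is admissible). Let $\mathcal G$ be any second-countable locally compact (Hausdorff) group containing $G$ as a closed subgroup of index $[\mathcal G:G]\ge |I|$, and let $L^2(\mathcal G)$ be taken with respect to a left Haar measure, with left translations $(L_xf)(y)=f(x^{-1}y)$. Then there are a closed subspace $V\subset L^2(\mathcal G)$ with $L_xV\subset V$ for all $x\in G$, and a unitary $U\colon\mathcal H\to V$ such that $U\pi(x)=L_xU$ for all $x\in G$. Consequently, $E$ is unitarily equivalent to the system of translates $\{L_xUu_i\}_{x\in G,\,i\in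 I}$ in $V$: there is a unitary from $\overline{\operatorname{span}}\{\pi(x)u_i\}$ onto $\overline{\operatorname{span}}\{L_xUu_i\}=V$ that maps $\pi(x)u_i$ to $L_xUu_i$ for all $x\in G$, $i\in I$. With the same $V$ and $U$, the same is true of every complete Bessel system $\{\pi(x)w_j\}_{x\in G,\,j\in J}$ generated by a countable family $\{w_j\}_{j\in J}$ in $\mathcal H$. -/

import Mathlib

open MeasureTheory
open scoped ENNReal

universe uG uH uI uS

noncomputable section

/-- A unitary representation of a topological group `G` on a complex Hilbert space `H`:
a homomorphism into the unitary group of `H` that is continuous for the strong operator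
topology. -/
structure UnitaryRep (G H : Type*) [Group G] [TopologicalSpace G]
    [NormedAddCommGroup H] [InnerProductSpace ℂ H] where
  /-- the underlying homomorphism -/
  toHom : G →* (H ≃ₗᵢ[ℂ] H)
  /-- strong continuity -/
  continuous_orbit : ∀ v : H, Continuous fun x : G => toHom x v

namespace UnitaryRep

variable {G H : Type*} [Group G] [TopologicalSpace G]
  [NormedAddCommGroup H] [InnerProductSpace ℂ H]

instance : CoeFun (UnitaryRep G H) (fun _ => G → (H ≃ₗᵢ[ℂ] H)) := ⟨fun π => π.toHom⟩

/-- Restriction of a representation of `G` along a continuous homomorphism `ι : K → G`. -/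
def restrict {K : Type*} [Group K] [TopologicalSpace K]
    (π : UnitaryRep G H) (ι : K →ₜ* G) : UnitaryRep K H where
  toHom := π.toHom.comp ι.toMonoidHom
  continuous_orbit v := (π.continuous_orbit v).comp ι.continuous_toFun

/-- The closed linear span of the system `E(u) = {π(x) u i}`, over `x ∈ G`, `i ∈ I`. -/
def orbitSpan (π : UnitaryRep G H) {I : Type*} (u : I → H) : Submodule ℂ H :=
  (Submodule.span ℂ (Set.range fun p : G × I => π p.1 (u p.2))).topologicalClosure

theorem mem_orbitSpan (π : UnitaryRep G H) {I : Type*} (u : I → H) (x : G) (i : I) :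
    π x (u i) ∈ π.orbitSpan u :=
  Submodule.le_topologicalClosure _ (Submodule.subset_span ⟨(x, i), rfl⟩)

/-- The system `E(u)` is complete: its closed linear span is the whole space. -/
def IsCompleteSystem (π : UnitaryRep G H) {I : Type*} (u : I → H) : Prop :=
  π.orbitSpan u = ⊤

/-- The system `E(u)` is Bessel with respect to the measure `μ` on `G`:
there is `B > 0` with `∑ i, ∫ |⟨v, π(x) u i⟩|² dμ(x) ≤ B ‖v‖²` for all `v`.
The left side is computed in `[0, ∞]`. -/
def IsBesselSystem [MeasurableSpace G] (π : UnitaryRep G H) (μ : Measure G)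
    {I : Type*} (u : I → H) : Prop :=
  ∃ B : ℝ, 0 < B ∧ ∀ v : H,
    ∑' i, ∫⁻ x, ENNReal.ofReal (‖inner ℂ v (π x (u i))‖ ^ 2) ∂μ ≤ ENNReal.ofReal (B * ‖v‖ ^ 2)

/-- Unitary equivalence of the systems `E(u)` (for `π`) and `E(u')` (for `π'`) with a common
index set: a unitary between their closed spans that maps `π(x) u i` to `π'(x) u' i`. -/
def SystemsEquivalent {H' : Type*} [NormedAddCommGroup H'] [InnerProductSpace ℂ H']
    {I : Type*} (π : UnitaryRep G H) (u : I → H) (π' : UnitaryRep G H') (u' : I → H') : Prop :=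
  ∃ W : π.orbitSpan u ≃ₗᵢ[ℂ] π'.orbitSpan u',
    ∀ (x : G) (i : I), W ⟨π x (u i), π.mem_orbitSpan u x i⟩ =
      ⟨π' x (u' i), π'.mem_orbitSpan u' x i⟩

end UnitaryRep

section LeftTranslation

variable {𝒢 : Type*} [Group 𝒢] [TopologicalSpace 𝒢] [IsTopologicalGroup 𝒢]
  [LocallyCompactSpace 𝒢] [SecondCountableTopology 𝒢] [T2Space 𝒢]
  [MeasurableSpace 𝒢] [BorelSpace 𝒢]

/-- The left translation operator `(L_x f)(y) = f(x⁻¹ y)` on `L²(𝒢, ν)`. -/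
def leftTranslate (ν : Measure 𝒢) [ν.IsHaarMeasure] (x : 𝒢) : Lp ℂ 2 ν →ₗᵢ[ℂ] Lp ℂ 2 ν :=
  Lp.compMeasurePreservingₗᵢ ℂ (fun y => x⁻¹ * y) (measurePreserving_mul_left ν x⁻¹)

theorem leftTranslate_ae (ν : Measure 𝒢) [ν.IsHaarMeasure] (x : 𝒢) (f : Lp ℂ 2 ν) :
    leftTranslate ν x f =ᵐ[ν] fun y => f (x⁻¹ * y) :=
  Lp.coeFn_compMeasurePreserving f (measurePreserving_mul_left ν x⁻¹)

theorem leftTranslate_one (ν : Measure 𝒢) [ν.IsHaarMeasure] (f : Lp ℂ 2 ν) :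
    leftTranslate ν 1 f = f := by
  apply Lp.ext
  filter_upwards [leftTranslate_ae ν 1 f] with y hy
  simpa using hy

theorem leftTranslate_mul (ν : Measure 𝒢) [ν.IsHaarMeasure] (x z : 𝒢) (f : Lp ℂ 2 ν) :
    leftTranslate ν (x * z) f = leftTranslate ν x (leftTranslate ν z f) := by
  apply Lp.ext
  have h := (measurePreserving_mul_left ν x⁻¹).quasiMeasurePreserving.ae
    (leftTranslate_ae ν z f)
  filter_upwards [leftTranslate_ae ν (x * z) f, leftTranslate_ae ν x (leftTranslate ν z f), h]
    with y h1 h2 h3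
  rw [h1, h2, h3, mul_inv_rev, mul_assoc]

/-- The left regular representation of `𝒢` on `L²(𝒢, ν)`, where `ν` is a left Haar measure. -/
def leftRegular (ν : Measure 𝒢) [ν.IsHaarMeasure] : UnitaryRep 𝒢 (Lp ℂ 2 ν) where
  toHom :=
    { toFun := fun x =>
        { (leftTranslate ν x).toLinearMap with
          invFun := leftTranslate ν x⁻¹
          left_inv := fun f => by
            change leftTranslate ν x⁻¹ (leftTranslate ν x f) = f
            rw [← leftTranslate_mul, inv_mul_cancel, leftTranslate_one]
          right_inv := fun f => by
            change leftTranslate ν x (leftTranslate ν x⁻¹ f) = f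
            rw [← leftTranslate_mul, mul_inv_cancel, leftTranslate_one]
          norm_map' := (leftTranslate ν x).norm_map }
      map_one' := by
        ext1 f
        exact leftTranslate_one ν f
      map_mul' := fun x z => by
        ext1 f
        exact leftTranslate_mul ν x z f }
  continuous_orbit f := by
    haveI : Fact ((2 : ℝ≥0∞) ≠ ∞) := ⟨by simp⟩
    have h : Continuous fun x : 𝒢 => DomMulAct.mk x⁻¹ • f :=
      (DomMulAct.continuous_mk.comp continuous_inv).smul continuous_const
    exact h

theorem leftRegular_ae (ν : Measure 𝒢) [ν.IsHaarMeasure] (x : 𝒢) (f : Lp ℂ 2 ν) :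
    leftRegular ν x f =ᵐ[ν] fun y => f (x⁻¹ * y) :=
  leftTranslate_ae ν x f

end LeftTranslation

end

/-! By the Bessel bound and completeness, the coefficient maps v ↦ ⟨π(x)u_i, v⟩ are bounded
intertwiners H → L²(G) with trivial common kernel. Suppose they can be replaced by countably many
bounded intertwiners H → L²(𝒢) whose values have disjoint supports, still with trivial common
kernel. A weighted sum is then one injective intertwiner S (`exists_injective_of_orthogonal`), and
the isometric part U of S = U|S| still intertwines
(`ContinuousLinearMap.exists_linearIsometry_of_injective`). Take V = range U; U carries every
complete system in H to one in V.

The passage from G to 𝒢 depends on the index. If it is finite, G is open and each coefficient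
function is placed on its own right coset of G; the bound on |I| provides enough cosets. If it is
infinite, G may be a null set, so the coefficient functions are smeared out by convolution with
bumps supported in disjoint open G-invariant sets. A single bump may annihilate a nonzero
coefficient function, so each i receives a whole sequence of concentrating bumps; I × ℕ is still
countable, so there are enough invariant sets. -/

/-! ### Polar decomposition of an injective intertwiner -/

open scoped InnerProductSpace in
/-- The isometric part of the polar decomposition of an injective operator `S`. It intertwines
every pair of unitaries that `S` intertwines. -/
theorem ContinuousLinearMap.exists_linearIsometry_of_injective {H K : Type*}
    [NormedAddCommGroup H] [InnerProductSpace ℂ H] [CompleteSpace H]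
    [NormedAddCommGroup K] [InnerProductSpace ℂ K] [CompleteSpace K]
    (S : H →L[ℂ] K) (hS : Function.Injective S) :
    ∃ U : H →ₗᵢ[ℂ] K, ∀ (a : H ≃ₗᵢ[ℂ] H) (b : K ≃ₗᵢ[ℂ] K),
      (∀ v, S (a v) = b (S v)) → ∀ v, U (a v) = b (U v) := by
  set P : H →L[ℂ] H := S.adjoint ∘L S with hP
  have hP0 : 0 ≤ P :=
    (ContinuousLinearMap.nonneg_iff_isPositive P).2 (ContinuousLinearMap.isPositive_adjoint_comp_self S)
  set R : H →L[ℂ] H := CFC.sqrt P with hR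
  have hR0 : 0 ≤ R := CFC.sqrt_nonneg P
  have hRR : R * R = P := CFC.sqrt_mul_sqrt_self P hP0
  have hRsa : R.adjoint = R := (ContinuousLinearMap.isSelfAdjoint_iff' (A := R)).1
    (IsSelfAdjoint.of_nonneg hR0)
  have hnorm : ∀ v, ‖R v‖ = ‖S v‖ := by
    intro v
    have h : inner ℂ (R v) (R v) = inner ℂ (S v) (S v) := by
      conv_lhs => rw [← ContinuousLinearMap.adjoint_inner_right, hRsa]
      rw [← ContinuousLinearMap.adjoint_inner_right S]
      exact congrArg (fun T : H →L[ℂ] H => inner ℂ v (T v)) hRR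
    rw [inner_self_eq_norm_sq_to_K, inner_self_eq_norm_sq_to_K] at h
    have h2 : ‖R v‖ ^ 2 = ‖S v‖ ^ 2 := by exact_mod_cast h
    exact (sq_eq_sq₀ (norm_nonneg _) (norm_nonneg _)).1 h2
  have hRker : ∀ v, R v = 0 → v = 0 := fun v hv => by
    have : S v = 0 := by rw [← norm_eq_zero, ← hnorm, hv, norm_zero]
    exact hS (this.trans (map_zero S).symm)
  have hdense : DenseRange R := by
    -- The complement of the range is the kernel of R* = R, which is trivial.
    have h : (LinearMap.range R.toLinearMap)ᗮ = ⊥ := by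
      rw [ContinuousLinearMap.orthogonal_range, hRsa]
      exact (Submodule.eq_bot_iff _).2 fun v hv => hRker v hv
    have h2 := (Submodule.topologicalClosure_eq_top_iff).2 h
    have h3 := (Submodule.dense_iff_topologicalClosure_eq_top).2 h2
    exact h3
  have hbd : ∀ v, ‖S v‖ ≤ 1 * ‖R v‖ := fun v => by rw [one_mul, hnorm]
  let U₀ : H →L[ℂ] K := S.toLinearMap.extendOfNorm R.toLinearMap
  have hU₀ : ∀ v, U₀ (R v) = S v := fun v =>
    LinearMap.extendOfNorm_eq (f := S.toLinearMap) (e := R.toLinearMap) hdense ⟨1, hbd⟩ v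
  let U : H →ₗᵢ[ℂ] K :=
    { U₀.toLinearMap with
      norm_map' := fun v => by
        refine hdense.induction_on (p := fun v => ‖U₀ v‖ = ‖v‖) v
          (isClosed_eq (by fun_prop) (by fun_prop)) fun w => ?_
        rw [hU₀, hnorm] }
  refine ⟨U, fun a b hab v => ?_⟩
  let A : H →L[ℂ] H := a.toContinuousLinearEquiv.toContinuousLinearMap
  -- S*S commutes with `a` because S intertwines `a` with `b` and both are unitary; its square root
  -- then commutes with `a` by functional calculus.
  have hPA : Commute P A := by
    refine ContinuousLinearMap.ext fun x => ext_inner_left ℂ fun y => ?_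
    change inner ℂ y (S.adjoint (S (a x))) = inner ℂ y (a (S.adjoint (S x)))
    have h1 : inner ℂ y (a (S.adjoint (S x))) = inner ℂ (a.symm y) (S.adjoint (S x)) := by
      rw [← a.inner_map_map (a.symm y), a.apply_symm_apply]
    rw [h1, ContinuousLinearMap.adjoint_inner_right, ContinuousLinearMap.adjoint_inner_right, hab,
      ← b.inner_map_map (S (a.symm y)), ← hab (a.symm y), a.apply_symm_apply]
  have hRA : Commute R A := by
    have := hPA.cfcₙ_nnreal NNReal.sqrt
    exact this
  have hRA' : ∀ w, R (a w) = a (R w) := fun w => congrArg (fun T : H →L[ℂ] H => T w) hRA.eq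
  change U₀ (a v) = b (U₀ v)
  refine hdense.induction_on (p := fun v => U₀ (a v) = b (U₀ v)) v
    (isClosed_eq (by fun_prop) (by fun_prop)) fun w => ?_
  rw [← hRA', hU₀, hU₀, hab]

/-! ### Transport of complete systems by an isometric intertwiner -/

namespace UnitaryRep

variable {G H K : Type*} [Group G] [TopologicalSpace G]
  [NormedAddCommGroup H] [InnerProductSpace ℂ H] [CompleteSpace H]
  [NormedAddCommGroup K] [InnerProductSpace ℂ K]

/-- An isometry from a complete space is a closed embedding, so taking images commutes with closure.
-/
theorem orbitSpan_comp_eq_range (π : UnitaryRep G H) (ρ : UnitaryRep G K) (U : H →ₗᵢ[ℂ] K)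
    (hU : ∀ x v, U (π x v) = ρ x (U v)) {J : Type*} (w : J → H) (hw : π.IsCompleteSystem w) :
    ρ.orbitSpan (fun j => U (w j)) = LinearMap.range U.toLinearMap := by
  have hcl : IsClosed (Set.range U) := U.isometry.isClosedEmbedding.isClosed_range
  have hset : (Set.range fun p : G × J => ρ p.1 (U (w p.2))) =
      U.toLinearMap '' Set.range fun p : G × J => π p.1 (w p.2) := by
    rw [← Set.range_comp]
    exact congrArg Set.range (funext fun p => (hU p.1 (w p.2)).symm)
  apply SetLike.coe_injective
  have h1 : closure (Submodule.span ℂ (Set.range fun p : G × J => π p.1 (w p.2)) : Set H) =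
      Set.univ := congrArg (fun s : Submodule ℂ H => (s : Set H)) hw
  change closure (Submodule.span ℂ (Set.range fun p : G × J => ρ p.1 (U (w p.2))) : Set K) =
    Set.range U
  rw [hset, Submodule.span_image]
  change closure (U '' _) = _
  rw [U.isometry.isClosedEmbedding.closure_image_eq, h1, Set.image_univ]

theorem systemsEquivalent_comp (π : UnitaryRep G H) (ρ : UnitaryRep G K) (U : H →ₗᵢ[ℂ] K)
    (hU : ∀ x v, U (π x v) = ρ x (U v)) {J : Type*} (w : J → H) (hw : π.IsCompleteSystem w) :
    π.SystemsEquivalent w ρ (fun j => U (w j)) := by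
  refine ⟨(LinearIsometryEquiv.ofTop H (π.orbitSpan w) hw).trans
    (U.equivRange.trans (LinearIsometryEquiv.ofEq _ _
      (orbitSpan_comp_eq_range π ρ U hU w hw).symm)), fun x j => ?_⟩
  exact Subtype.ext (hU x (w j))

omit [CompleteSpace H] in
theorem exists_inner_ne_zero {π : UnitaryRep G H} {I : Type*} {u : I → H}
    (hu : π.IsCompleteSystem u) {v : H} (hv : v ≠ 0) :
    ∃ x i, inner ℂ (π x (u i)) v ≠ 0 := by
  by_contra! h
  apply hv
  have hdense : Dense (Submodule.span ℂ (Set.range fun p : G × I => π p.1 (u p.2)) : Set H) :=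
    Submodule.dense_iff_topologicalClosure_eq_top.2 hu
  refine hdense.eq_zero_of_inner_right ℂ fun z hz => ?_
  induction hz using Submodule.span_induction with
  | mem z hz => obtain ⟨p, rfl⟩ := hz; exact h p.1 p.2
  | zero => simp
  | add a b _ _ ha hb => simp_all [inner_add_left]
  | smul c a _ ha => simp_all [inner_smul_left]

end UnitaryRep

/-! ### Combining operators into L² with disjoint supports -/

theorem exists_continuousLinearMap_toLp {X H : Type*} [MeasurableSpace X] (ν : Measure X)
    [NormedAddCommGroup H] [NormedSpace ℂ H] (F : H → X → ℂ)
    (hadd : ∀ v w y, F (v + w) y = F v y + F w y) (hsmul : ∀ (c : ℂ) v y, F (c • v) y = c * F v y)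
    (hmeas : ∀ v, AEStronglyMeasurable (F v) ν) (C : ℝ≥0∞) (hC : C ≠ ∞)
    (hbd : ∀ v, ∫⁻ y, ‖F v y‖ₑ ^ 2 ∂ν ≤ C * ‖v‖ₑ ^ 2) :
    ∃ T : H →L[ℂ] Lp ℂ 2 ν, ∀ v, T v =ᵐ[ν] F v := by
  have hnorm : ∀ v, eLpNorm (F v) 2 ν ≤ C ^ (1 / 2 : ℝ) * ‖v‖ₑ := by
    intro v
    rw [eLpNorm_eq_lintegral_rpow_enorm_toReal (by norm_num) (by norm_num)]
    simp only [ENNReal.toReal_ofNat, ENNReal.rpow_ofNat]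
    calc (∫⁻ y, ‖F v y‖ₑ ^ 2 ∂ν) ^ (1 / 2 : ℝ) ≤ (C * ‖v‖ₑ ^ 2) ^ (1 / 2 : ℝ) :=
          ENNReal.rpow_le_rpow (hbd v) (by norm_num)
      _ = C ^ (1 / 2 : ℝ) * ‖v‖ₑ := by
          rw [ENNReal.mul_rpow_of_nonneg _ _ (by norm_num), ← ENNReal.rpow_ofNat,
            ← ENNReal.rpow_mul]
          norm_num
  have hfin : C ^ (1 / 2 : ℝ) ≠ ∞ := ENNReal.rpow_ne_top_of_nonneg (by norm_num) hC
  have hmem : ∀ v, MemLp (F v) 2 ν := fun v =>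
    ⟨hmeas v, (hnorm v).trans_lt (ENNReal.mul_lt_top hfin.lt_top enorm_lt_top)⟩
  let T₀ : H →ₗ[ℂ] Lp ℂ 2 ν :=
    { toFun := fun v => (hmem v).toLp (F v)
      map_add' := fun v w => by
        rw [← MemLp.toLp_add]
        exact MemLp.toLp_congr _ _ (Filter.Eventually.of_forall fun y => hadd v w y)
      map_smul' := fun c v => by
        rw [RingHom.id_apply, ← MemLp.toLp_const_smul]
        exact MemLp.toLp_congr _ _ (Filter.Eventually.of_forall fun y => hsmul c v y) }
  refine ⟨T₀.mkContinuous (C ^ (1 / 2 : ℝ)).toReal fun v => ?_, fun v => (hmem v).coeFn_toLp⟩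
  change ‖(hmem v).toLp (F v)‖ ≤ _
  rw [Lp.norm_toLp, ← toReal_enorm v, ← ENNReal.toReal_mul]
  exact ENNReal.toReal_mono (ENNReal.mul_ne_top hfin enorm_ne_top) (hnorm v)

/-- Countably many operators with pointwise orthogonal values and trivial common kernel combine to
an injective operator, intertwining every pair of unitaries that each of them intertwines. -/
theorem exists_injective_of_orthogonal {N H K : Type*} [Countable N]
    [NormedAddCommGroup H] [InnerProductSpace ℂ H]
    [NormedAddCommGroup K] [InnerProductSpace ℂ K] [CompleteSpace K]
    (T : N → H →L[ℂ] K) (horth : ∀ m n, m ≠ n → ∀ v, inner ℂ (T m v) (T n v) = 0)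
    (hker : ∀ v, (∀ n, T n v = 0) → v = 0) :
    ∃ S : H →L[ℂ] K, Function.Injective S ∧ ∀ (a : H ≃ₗᵢ[ℂ] H) (b : K ≃ₗᵢ[ℂ] K),
      (∀ n v, T n (a v) = b (T n v)) → ∀ v, S (a v) = b (S v) := by
  obtain ⟨ε, hε, c, hc, -⟩ := NNReal.exists_pos_sum_of_countable one_ne_zero N
  -- These weights make the series converge in operator norm; the 1 avoids division by zero.
  let d : N → ℝ := fun n => ε n / (1 + ‖T n‖)
  have hd : ∀ n, 0 < d n := fun n => div_pos (NNReal.coe_pos.2 (hε n)) (by positivity)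
  have hsum : Summable fun n => (d n : ℂ) • T n := by
    refine Summable.of_norm_bounded (NNReal.summable_coe.2 hc.summable) fun n => ?_
    rw [norm_smul, Complex.norm_real, Real.norm_of_nonneg (hd n).le]
    have h0 := norm_nonneg (T n)
    change (ε n : ℝ) / (1 + ‖T n‖) * ‖T n‖ ≤ ε n
    rw [div_mul_eq_mul_div, div_le_iff₀ (by positivity)]
    exact mul_le_mul_of_nonneg_left (by linarith) (ε n).2
  let S : H →L[ℂ] K := ∑' n, (d n : ℂ) • T n
  have hS : ∀ v, HasSum (fun n => (d n : ℂ) • T n v) (S v) := fun v =>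
    hsum.hasSum.mapL (ContinuousLinearMap.apply ℂ K v)
  refine ⟨S, (injective_iff_map_eq_zero S).2 fun v hv => hker v fun n => ?_, fun a b hab v => ?_⟩
  -- Pairing S v = 0 with T n v leaves, by orthogonality, only d n ‖T n v‖².
  · have h1 := (hS v).mapL (innerSL ℂ (T n v))
    have h2 : HasSum (fun m => inner ℂ (T n v) ((d m : ℂ) • T m v))
        (inner ℂ (T n v) ((d n : ℂ) • T n v)) := hasSum_single n fun m hm => by
      rw [inner_smul_right, horth n m hm.symm, mul_zero]
    have h3 : inner ℂ (T n v) (S v) = inner ℂ (T n v) ((d n : ℂ) • T n v) := h1.unique h2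
    rw [hv, inner_zero_right, inner_smul_right, eq_comm, mul_eq_zero] at h3
    exact inner_self_eq_zero.1 (h3.resolve_left (Complex.ofReal_ne_zero.2 (hd n).ne'))
  · have h1 : HasSum (fun n => b ((d n : ℂ) • T n v)) (b (S v)) :=
      (hS v).mapL b.toContinuousLinearEquiv.toContinuousLinearMap
    refine (hS (a v)).unique ?_
    simpa only [map_smul, hab] using h1

namespace UnitaryRep

/-- A countable jointly injective family of bounded intertwiners from `H` to `L²(𝒢, ν)`, given by
functions with disjoint supports, yields an isometric intertwiner. -/
theorem exists_intertwining_linearIsometry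
    {G : Type*} [Group G] [TopologicalSpace G]
    {H : Type*} [NormedAddCommGroup H] [InnerProductSpace ℂ H] [CompleteSpace H]
    (π : UnitaryRep G H)
    {𝒢 : Type*} [Group 𝒢] [TopologicalSpace 𝒢] [IsTopologicalGroup 𝒢]
    [LocallyCompactSpace 𝒢] [SecondCountableTopology 𝒢] [T2Space 𝒢]
    [MeasurableSpace 𝒢] [BorelSpace 𝒢] (ν : Measure 𝒢) [ν.IsHaarMeasure] (ι : G →ₜ* 𝒢)
    {N : Type*} [Countable N] (F : N → H → 𝒢 → ℂ)
    (hadd : ∀ n v w y, F n (v + w) y = F n v y + F n w y)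
    (hsmul : ∀ n (c : ℂ) v y, F n (c • v) y = c * F n v y)
    (hmeas : ∀ n v, AEStronglyMeasurable (F n v) ν)
    (hbd : ∀ n, ∃ C : ℝ≥0∞, C ≠ ∞ ∧ ∀ v, ∫⁻ y, ‖F n v y‖ₑ ^ 2 ∂ν ≤ C * ‖v‖ₑ ^ 2)
    (hequiv : ∀ n x v y, F n (π x v) y = F n v ((ι x)⁻¹ * y))
    (hdisj : ∀ m n, m ≠ n → ∀ v y, F m v y = 0 ∨ F n v y = 0)
    (hker : ∀ v, (∀ n, F n v =ᵐ[ν] 0) → v = 0) :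
    ∃ U : H →ₗᵢ[ℂ] Lp ℂ 2 ν, ∀ x v, U (π x v) = leftRegular ν (ι x) (U v) := by
  choose C hC hCbd using hbd
  choose T hT using fun n => exists_continuousLinearMap_toLp ν (F n) (hadd n) (hsmul n) (hmeas n)
    (C n) (hC n) (hCbd n)
  obtain ⟨S, hS, hSint⟩ := exists_injective_of_orthogonal T
    (fun m n hmn v => by
      rw [L2.inner_def]
      refine integral_eq_zero_of_ae ?_
      filter_upwards [hT m v, hT n v] with y h1 h2
      rw [h1, h2]
      rcases hdisj m n hmn v y with h | h <;> simp [h])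
    (fun v hv => hker v fun n => by
      refine (hT n v).symm.trans ?_
      rw [hv n]
      exact Lp.coeFn_zero _ _ _)
  obtain ⟨U, hU⟩ := S.exists_linearIsometry_of_injective hS
  refine ⟨U, fun x => hU (π x) (leftRegular ν (ι x)) (hSint _ _ fun n v => ?_)⟩
  apply Lp.ext
  have h := (measurePreserving_mul_left ν (ι x)⁻¹).quasiMeasurePreserving.ae (hT n v)
  filter_upwards [hT n (π x v), leftRegular_ae ν (ι x) (T n v), h] with y h1 h2 h3
  rw [h1, h2, h3, hequiv]

end UnitaryRep

/-! ### Open subgroups: one coset per generator -/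

namespace UnitaryRep

variable {G : Type*} [Group G] [TopologicalSpace G] [IsTopologicalGroup G]
  [LocallyCompactSpace G] [SecondCountableTopology G]
  [MeasurableSpace G] [BorelSpace G] {μ : Measure G} [μ.IsHaarMeasure]
  {H : Type*} [NormedAddCommGroup H] [InnerProductSpace ℂ H]
  {π : UnitaryRep G H} {I : Type*} {u : I → H}
  {𝒢 : Type*} [Group 𝒢] [TopologicalSpace 𝒢] [IsTopologicalGroup 𝒢]
  [LocallyCompactSpace 𝒢] [SecondCountableTopology 𝒢] [T2Space 𝒢]
  [MeasurableSpace 𝒢] [BorelSpace 𝒢] {ν : Measure 𝒢} [ν.IsHaarMeasure] {ι : G →ₜ* 𝒢}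

omit [IsTopologicalGroup G] [LocallyCompactSpace G] [SecondCountableTopology G] [BorelSpace G]
  [μ.IsHaarMeasure] in
theorem IsBesselSystem.exists_lintegral_le (h : π.IsBesselSystem μ u) :
    ∃ C : ℝ≥0∞, C ≠ ∞ ∧ ∀ i v, ∫⁻ x, ‖inner ℂ (π x (u i)) v‖ₑ ^ 2 ∂μ ≤ C * ‖v‖ₑ ^ 2 := by
  obtain ⟨B, hB, h⟩ := h
  refine ⟨ENNReal.ofReal B, ENNReal.ofReal_ne_top, fun i v => ?_⟩
  have h1 := (ENNReal.le_tsum i).trans (h v)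
  rw [ENNReal.ofReal_mul hB.le, ENNReal.ofReal_pow (norm_nonneg _), ofReal_norm] at h1
  refine le_trans (le_of_eq (lintegral_congr fun x => ?_)) h1
  rw [ENNReal.ofReal_pow (norm_nonneg _), norm_inner_symm, ofReal_norm]

omit [IsTopologicalGroup G] [LocallyCompactSpace G] [SecondCountableTopology G]
  [MeasurableSpace G] [BorelSpace G] in
theorem continuous_coefficient (π : UnitaryRep G H) (w v : H) :
    Continuous fun x => inner ℂ (π x w) v :=
  (π.continuous_orbit w).inner continuous_const

omit [IsTopologicalGroup G] [LocallyCompactSpace G] [SecondCountableTopology G]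
  [MeasurableSpace G] [BorelSpace G] in
theorem coefficient_apply_right (π : UnitaryRep G H) (w v : H) (g x : G) :
    inner ℂ (π x w) (π g v) = inner ℂ (π (g⁻¹ * x) w) v := by
  have h : π x w = π g (π (g⁻¹ * x) w) := by
    have h2 : π.toHom (g * (g⁻¹ * x)) w = π.toHom g (π.toHom (g⁻¹ * x) w) := by
      rw [map_mul]; rfl
    rwa [mul_inv_cancel_left] at h2
  rw [h, LinearIsometryEquiv.inner_map_map]

-- Right translation preserves left invariance, so the translated measure pulls back to a left Haar
-- measure on G, a multiple of μ by uniqueness. The multiple may depend on s, since 𝒢 need not be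
-- unimodular.
omit [LocallyCompactSpace 𝒢] [SecondCountableTopology 𝒢] [T2Space 𝒢] in
theorem exists_lintegral_extend_eq (hι : Topology.IsOpenEmbedding ι) (s : 𝒢) :
    ∃ C : ℝ≥0∞, C ≠ ∞ ∧ ∀ c : G → ℂ,
      ∫⁻ y, ‖Function.extend ι c 0 (y * s)‖ₑ ^ 2 ∂ν = C * ∫⁻ x, ‖c x‖ₑ ^ 2 ∂μ := by
  let ν' : Measure 𝒢 := ν.map (· * s)
  have hHaar : (ν'.comap ι).IsHaarMeasure :=
    Measure.IsHaarMeasure.comap (mH := ContinuousMul.measurableMul) ν' (f := (ι : G →* 𝒢)) hι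
  have hme : MeasurableEmbedding ι := hι.measurableEmbedding
  refine ⟨Measure.haarScalarFactor (ν'.comap ι) μ, ENNReal.coe_ne_top, fun c => ?_⟩
  calc ∫⁻ y, ‖Function.extend ι c 0 (y * s)‖ₑ ^ 2 ∂ν
      = ∫⁻ z, ‖Function.extend ι c 0 z‖ₑ ^ 2 ∂ν' :=
        ((measurableEmbedding_mulRight s).lintegral_map
          fun z => ‖Function.extend ι c 0 z‖ₑ ^ 2).symm
    _ = ∫⁻ z in Set.range ι, ‖Function.extend ι c 0 z‖ₑ ^ 2 ∂ν' := by
        rw [← lintegral_indicator hme.measurableSet_range]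
        refine lintegral_congr fun z => ?_
        by_cases hz : z ∈ Set.range ι
        · rw [Set.indicator_of_mem hz]
        · rw [Set.indicator_of_notMem hz, Function.extend_apply' _ _ _ hz]
          simp
    _ = ∫⁻ x, ‖c x‖ₑ ^ 2 ∂(ν'.comap ι) := by
        rw [← hme.map_comap, hme.lintegral_map]
        simp [hme.injective.extend_apply]
    _ = _ := by
        conv_lhs => rw [Measure.isMulLeftInvariant_eq_smul (ν'.comap ι) μ]
        rw [lintegral_smul_measure]
        rfl

variable [CompleteSpace H]

theorem exists_intertwining_linearIsometry_of_isOpenEmbedding (hu : π.IsCompleteSystem u)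
    (hB : π.IsBesselSystem μ u) [Countable I] (hι : Topology.IsOpenEmbedding ι)
    (e : I → 𝒢 ⧸ (ι : G →* 𝒢).range) (he : Function.Injective e) :
    ∃ U : H →ₗᵢ[ℂ] Lp ℂ 2 ν, ∀ x v, U (π x v) = leftRegular ν (ι x) (U v) := by
  obtain ⟨B, hB, hBb⟩ := hB.exists_lintegral_le
  have hinj := hι.injective
  -- With s the representative of e i, the support lies in the right coset ι(G)s⁻¹: right cosets are
  -- invariant under left translation by G, and inversion matches them with the left cosets that e
  -- takes values in.
  let F : I → H → 𝒢 → ℂ := fun i v y =>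
    Function.extend ι (fun x => inner ℂ (π x (u i)) v) 0 (y * (e i).out)
  have hF : ∀ i v y x, ι x = y * (e i).out → F i v y = inner ℂ (π x (u i)) v := fun i v y x h => by
    change Function.extend _ _ _ _ = _
    rw [← h, hinj.extend_apply]
  have hF0 : ∀ i v y, (¬ ∃ x, ι x = y * (e i).out) → F i v y = 0 := fun i v y h =>
    Function.extend_apply' _ _ _ h
  have hFop : ∀ i v, IsOpen {y | F i v y ≠ 0} := fun i v => by
    have : {y | F i v y ≠ 0} =
        (fun y => y * (e i).out) ⁻¹' (ι '' {x | inner ℂ (π x (u i)) v ≠ 0}) := by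
      ext y
      constructor
      · intro hy
        obtain ⟨x, hx⟩ := not_not.1 (mt (hF0 i v y) hy)
        exact ⟨x, by rwa [Set.mem_ofPred_eq, ← hF i v y x hx], hx⟩
      · rintro ⟨x, hx, hxy⟩
        rwa [Set.mem_ofPred_eq, hF i v y x hxy]
    rw [this]
    exact (hι.isOpenMap _ (isOpen_ne_fun (π.continuous_coefficient _ _)
      continuous_const)).preimage (continuous_mul_const _)
  refine exists_intertwining_linearIsometry π ν ι F (fun i v w y => ?_) (fun i c v y => ?_)
    (fun i v => ?_) (fun i => ?_) (fun i g v y => ?_) (fun i j hij v y => ?_) (fun v hv => ?_)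
  · by_cases h : ∃ x, ι x = y * (e i).out
    · obtain ⟨x, hx⟩ := h
      simp only [hF _ _ _ _ hx, inner_add_right]
    · simp only [hF0 _ _ _ h, add_zero]
  · by_cases h : ∃ x, ι x = y * (e i).out
    · obtain ⟨x, hx⟩ := h
      simp only [hF _ _ _ _ hx, inner_smul_right]
    · simp only [hF0 _ _ _ h, mul_zero]
  · have hm : Measurable (Function.extend ι (fun x => inner ℂ (π x (u i)) v) 0) :=
      hι.measurableEmbedding.measurable_extend (π.continuous_coefficient _ _).measurable
        measurable_const
    exact (hm.comp (measurable_mul_const _)).aestronglyMeasurable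
  · obtain ⟨C, hC, hCe⟩ := exists_lintegral_extend_eq (μ := μ) (ν := ν) hι (e i).out
    refine ⟨C * B, ENNReal.mul_ne_top hC hB, fun v => ?_⟩
    rw [mul_assoc]
    exact (hCe _).trans_le (mul_le_mul_right (hBb i v) C)
  · by_cases h : ∃ x, ι x = y * (e i).out
    · obtain ⟨x, hx⟩ := h
      rw [hF _ _ _ _ hx, hF i v _ (g⁻¹ * x) (by rw [map_mul, map_inv, hx, mul_assoc]),
        coefficient_apply_right]
    · rw [hF0 _ _ _ h, hF0]
      rintro ⟨x, hx⟩
      exact h ⟨g * x, by rw [map_mul, hx]; group⟩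
  · by_contra! h
    obtain ⟨x, hx⟩ := not_not.1 (mt (hF0 i v y) h.1)
    obtain ⟨z, hz⟩ := not_not.1 (mt (hF0 j v y) h.2)
    apply hij
    apply he
    rw [← (e i).out_eq', ← (e j).out_eq']
    refine QuotientGroup.eq.2 ⟨x⁻¹ * z, ?_⟩
    change ι (x⁻¹ * z) = _
    rw [map_mul, map_inv, hx, hz]
    group
  · by_contra hv0
    obtain ⟨x, i, hxi⟩ := exists_inner_ne_zero hu hv0
    -- Haar measure charges nonempty open sets, so almost everywhere vanishing becomes vanishing.
    have h0 : ν {y | F i v y ≠ 0} = 0 := hv i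
    rw [(hFop i v).measure_eq_zero_iff ν] at h0
    have : ι x * (e i).out⁻¹ ∈ {y | F i v y ≠ 0} := by
      rw [Set.mem_ofPred_eq, hF i v _ x (by group)]
      exact hxi
    rw [h0] at this
    exact this

end UnitaryRep

/-! ### Closed subgroups of infinite index: convolution with bumps -/

-- If x₀ contributes for y, left invariance recentres the integral at x₀, and every contributing x
-- then lies in the preimage of KK⁻¹, a compact set independent of y.
open scoped Pointwise in
theorem ContinuousMonoidHom.exists_lintegral_comp_inv_mul_le
    {G : Type*} [Group G] [TopologicalSpace G] [IsTopologicalGroup G]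
    [MeasurableSpace G] [BorelSpace G] (μ : Measure G) [μ.IsHaarMeasure]
    {𝒢 : Type*} [Group 𝒢] [TopologicalSpace 𝒢] [IsTopologicalGroup 𝒢]
    {ι : G →ₜ* 𝒢} (hι : Topology.IsClosedEmbedding ι) {φ : 𝒢 → ℝ}
    (hφs : HasCompactSupport φ) (hφ1 : ∀ y, ‖φ y‖ ≤ 1) :
    ∃ M : ℝ≥0∞, M ≠ ∞ ∧ ∀ y, ∫⁻ x, ‖φ ((ι x)⁻¹ * y)‖ₑ ∂μ ≤ M := by
  set K := tsupport φ
  have hK : IsCompact (ι ⁻¹' (K * K⁻¹)) := hι.isCompact_preimage (hφs.isCompact.mul hφs.isCompact.inv)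
  refine ⟨μ (ι ⁻¹' (K * K⁻¹)), hK.measure_ne_top, fun y => ?_⟩
  have hle : ∀ z, ‖φ z‖ₑ ≤ 1 := fun z => by
    rw [← ofReal_norm, ← ENNReal.ofReal_one]
    exact ENNReal.ofReal_le_ofReal (hφ1 z)
  by_cases h : ∃ x₀, (ι x₀)⁻¹ * y ∈ K
  · obtain ⟨x₀, hx₀⟩ := h
    rw [← lintegral_mul_left_eq_self _ x₀]
    calc ∫⁻ x, ‖φ ((ι (x₀ * x))⁻¹ * y)‖ₑ ∂μ
        ≤ ∫⁻ x, (toMeasurable μ (ι ⁻¹' (K * K⁻¹))).indicator 1 x ∂μ := by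
          refine lintegral_mono fun x => ?_
          by_cases hx : x ∈ ι ⁻¹' (K * K⁻¹)
          · rw [Set.indicator_of_mem (subset_toMeasurable _ _ hx)]
            exact hle _
          · have : (ι (x₀ * x))⁻¹ * y ∉ K := fun hmem => hx <| by
              refine ⟨(ι x₀)⁻¹ * y, hx₀, ((ι (x₀ * x))⁻¹ * y)⁻¹, Set.inv_mem_inv.2 hmem, ?_⟩
              simp only [map_mul]
              group
            rw [image_eq_zero_of_notMem_tsupport this, enorm_zero]
            exact zero_le
      _ = μ (ι ⁻¹' (K * K⁻¹)) := by
          rw [lintegral_indicator_one (measurableSet_toMeasurable _ _), measure_toMeasurable]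
  · push Not at h
    simp [image_eq_zero_of_notMem_tsupport (h _)]

theorem ENNReal.sq_lintegral_mul_le {X : Type*} [MeasurableSpace X] (μ : Measure X)
    {w c : X → ℝ≥0∞} (hw : Measurable w) (hc : Measurable c) :
    (∫⁻ x, w x * c x ∂μ) ^ 2 ≤ (∫⁻ x, w x ∂μ) * ∫⁻ x, w x * c x ^ 2 ∂μ := by
  have h := ENNReal.lintegral_mul_le_Lp_mul_Lq μ Real.HolderConjugate.two_two
    (f := fun x => w x ^ (1 / 2 : ℝ)) (g := fun x => w x ^ (1 / 2 : ℝ) * c x)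
    (by fun_prop) (by fun_prop)
  have hsq : ∀ a : ℝ≥0∞, (a ^ (1 / 2 : ℝ)) ^ 2 = a := fun a => by
    rw [← ENNReal.rpow_ofNat, ← ENNReal.rpow_mul]
    norm_num
  have hsq' : ∀ a : ℝ≥0∞, (a ^ (1 / 2 : ℝ)) ^ (2 : ℝ) = a := fun a => by
    rw [← ENNReal.rpow_mul]
    norm_num
  have hl : ∀ x, ((fun x => w x ^ (1 / 2 : ℝ)) * fun x => w x ^ (1 / 2 : ℝ) * c x) x = w x * c x :=
    fun x => by
      change w x ^ (1 / 2 : ℝ) * (w x ^ (1 / 2 : ℝ) * c x) = _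
      rw [← mul_assoc, ← sq, hsq]
  simp only [hl, ENNReal.mul_rpow_of_nonneg _ _ zero_le_two, hsq'] at h
  simp only [ENNReal.rpow_ofNat] at h
  calc _ ≤ _ := pow_le_pow_left' h 2
    _ = _ := by rw [mul_pow, hsq, hsq]

namespace UnitaryRep

variable {G : Type*} [Group G] [TopologicalSpace G] [IsTopologicalGroup G]
  [LocallyCompactSpace G] [SecondCountableTopology G]
  [MeasurableSpace G] [BorelSpace G] {μ : Measure G} [μ.IsHaarMeasure]
  {H : Type*} [NormedAddCommGroup H] [InnerProductSpace ℂ H]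
  {π : UnitaryRep G H} {I : Type*} {u : I → H}
  {𝒢 : Type*} [Group 𝒢] [TopologicalSpace 𝒢] [IsTopologicalGroup 𝒢]
  [LocallyCompactSpace 𝒢] [SecondCountableTopology 𝒢] [T2Space 𝒢]
  [MeasurableSpace 𝒢] [BorelSpace 𝒢] {ν : Measure 𝒢} [ν.IsHaarMeasure] {ι : G →ₜ* 𝒢}

-- A Schur test: Cauchy–Schwarz with weight |φ|, whose mass along G is uniformly bounded, then
-- Tonelli and left invariance of ν.
omit [T2Space 𝒢] in
theorem exists_lintegral_convolution_le (hι : Topology.IsClosedEmbedding ι) {φ : 𝒢 → ℝ}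
    (hφ : Continuous φ) (hφs : HasCompactSupport φ) (hφ1 : ∀ y, ‖φ y‖ ≤ 1) :
    ∃ C : ℝ≥0∞, C ≠ ∞ ∧ ∀ c : G → ℂ, Continuous c →
      ∫⁻ y, ‖∫ x, (φ ((ι x)⁻¹ * y) : ℂ) * c x ∂μ‖ₑ ^ 2 ∂ν ≤ C * ∫⁻ x, ‖c x‖ₑ ^ 2 ∂μ := by
  obtain ⟨M, hM, hMb⟩ := ContinuousMonoidHom.exists_lintegral_comp_inv_mul_le μ hι hφs hφ1
  have hL1 : ∫⁻ y, ‖φ y‖ₑ ∂ν ≠ ∞ := (hφ.integrable_of_hasCompactSupport hφs).2.ne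
  refine ⟨M * ∫⁻ y, ‖φ y‖ₑ ∂ν, ENNReal.mul_ne_top hM hL1, fun c hc => ?_⟩
  have hιc : Continuous ι := hι.continuous
  have hker : Continuous fun p : 𝒢 × G => φ ((ι p.2)⁻¹ * p.1) := by fun_prop
  have hker₁ : ∀ y, Continuous fun x : G => φ ((ι x)⁻¹ * y) := fun y => by fun_prop
  have hpt : ∀ y, ‖∫ x, (φ ((ι x)⁻¹ * y) : ℂ) * c x ∂μ‖ₑ ^ 2 ≤
      M * ∫⁻ x, ‖φ ((ι x)⁻¹ * y)‖ₑ * ‖c x‖ₑ ^ 2 ∂μ := fun y => by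
    have h1 : ‖∫ x, (φ ((ι x)⁻¹ * y) : ℂ) * c x ∂μ‖ₑ ≤
        ∫⁻ x, ‖φ ((ι x)⁻¹ * y)‖ₑ * ‖c x‖ₑ ∂μ := by
      refine (enorm_integral_le_lintegral_enorm _).trans (le_of_eq (lintegral_congr fun x => ?_))
      rw [enorm_mul, ← ofReal_norm (φ _ : ℂ), Complex.norm_real, ofReal_norm]
    calc _ ≤ _ := pow_le_pow_left' h1 2
      _ ≤ _ := ENNReal.sq_lintegral_mul_le μ (hker₁ y).enorm.measurable hc.enorm.measurable
      _ ≤ _ := mul_le_mul_left (hMb y) _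
  calc _ ≤ ∫⁻ y, M * ∫⁻ x, ‖φ ((ι x)⁻¹ * y)‖ₑ * ‖c x‖ₑ ^ 2 ∂μ ∂ν := lintegral_mono hpt
    _ = M * ∫⁻ y, ∫⁻ x, ‖φ ((ι x)⁻¹ * y)‖ₑ * ‖c x‖ₑ ^ 2 ∂μ ∂ν := lintegral_const_mul' _ _ hM
    _ = M * ∫⁻ x, ∫⁻ y, ‖φ ((ι x)⁻¹ * y)‖ₑ * ‖c x‖ₑ ^ 2 ∂ν ∂μ := by
        rw [lintegral_lintegral_swap]
        exact (hker.enorm.measurable.mul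
          ((hc.enorm.measurable.comp measurable_snd).pow_const 2)).aemeasurable
    _ = M * ∫⁻ x, (∫⁻ y, ‖φ y‖ₑ ∂ν) * ‖c x‖ₑ ^ 2 ∂μ := by
        congr 1
        refine lintegral_congr fun x => ?_
        have hm : Measurable fun y => ‖φ ((ι x)⁻¹ * y)‖ₑ :=
          (hφ.comp (continuous_const_mul _)).enorm.measurable
        rw [lintegral_mul_const _ hm,
          lintegral_mul_left_eq_self (fun y => ‖φ y‖ₑ) (ι x)⁻¹]
    _ = _ := by rw [lintegral_const_mul' _ _ hL1, mul_assoc]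

-- For y in a compact neighbourhood t, the integrands vanish outside one compact set, the preimage
-- of t(supp φ)⁻¹.
open scoped Pointwise in
omit [IsTopologicalGroup G] [LocallyCompactSpace G] [SecondCountableTopology G]
  [SecondCountableTopology 𝒢] [T2Space 𝒢] [MeasurableSpace 𝒢] [BorelSpace 𝒢] in
theorem continuous_convolution (hι : Topology.IsClosedEmbedding ι) {φ : 𝒢 → ℝ}
    (hφ : Continuous φ) (hφs : HasCompactSupport φ) {c : G → ℂ} (hc : Continuous c) :
    Continuous fun y => ∫ x, (φ ((ι x)⁻¹ * y) : ℂ) * c x ∂μ := by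
  rw [continuous_iff_continuousAt]
  intro y₀
  obtain ⟨t, ht, hty⟩ := exists_compact_mem_nhds y₀
  have hιc : Continuous ι := hι.continuous
  refine ContinuousOn.continuousAt (s := t) ?_ hty
  refine continuousOn_integral_of_compact_support
    (hι.isCompact_preimage (ht.mul hφs.isCompact.inv)) ?_ fun y x hy hx => ?_
  · have : Continuous fun p : 𝒢 × G => (φ ((ι p.2)⁻¹ * p.1) : ℂ) * c p.2 := by fun_prop
    exact this.continuousOn
  · have : (ι x)⁻¹ * y ∉ tsupport φ := fun hmem =>
      hx ⟨y, hy, ((ι x)⁻¹ * y)⁻¹, Set.inv_mem_inv.2 hmem, by group⟩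
    rw [image_eq_zero_of_notMem_tsupport this, Complex.ofReal_zero, zero_mul]

omit [IsTopologicalGroup G] [LocallyCompactSpace G] [SecondCountableTopology G]
  [LocallyCompactSpace 𝒢] [SecondCountableTopology 𝒢] [T2Space 𝒢]
  [MeasurableSpace 𝒢] [BorelSpace 𝒢] in
theorem integrable_convolution_integrand (hι : Topology.IsClosedEmbedding ι) {φ : 𝒢 → ℝ}
    (hφ : Continuous φ) (hφs : HasCompactSupport φ) {c : G → ℂ} (hc : Continuous c) (y : 𝒢) :
    Integrable (fun x => (φ ((ι x)⁻¹ * y) : ℂ) * c x) μ := by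
  have hιc : Continuous ι := hι.continuous
  have hs : HasCompactSupport fun x => φ ((ι x)⁻¹ * y) :=
    hφs.comp_isClosedEmbedding
      (((Homeomorph.inv 𝒢).trans (Homeomorph.mulRight y)).isClosedEmbedding.comp hι)
  refine Continuous.integrable_of_hasCompactSupport (by fun_prop) ?_
  exact HasCompactSupport.mul_right (hs.comp_left (g := Complex.ofReal) Complex.ofReal_zero)

omit [LocallyCompactSpace 𝒢] [SecondCountableTopology 𝒢] [T2Space 𝒢]
  [MeasurableSpace 𝒢] [BorelSpace 𝒢] in
/-- If a closed subgroup has infinite index, there are infinitely many disjoint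
nonempty open sets invariant under left multiplication by the subgroup. -/
theorem _root_.Subgroup.exists_seq_isOpen_invariant_disjoint (K : Subgroup 𝒢)
    (hK : IsClosed (K : Set 𝒢)) [Infinite (𝒢 ⧸ K)] :
    ∃ A : ℕ → Set 𝒢, (∀ n, (A n).Nonempty) ∧ (∀ n, IsOpen (A n)) ∧
      (∀ n, ∀ k ∈ K, ∀ y, k * y ∈ A n ↔ y ∈ A n) ∧ Pairwise (Function.onFun Disjoint A) := by
  have : T2Space (𝒢 ⧸ K) := inferInstance
  obtain ⟨O, hO, hOo, hOd⟩ := exists_seq_infinite_isOpen_pairwise_disjoint (𝒢 ⧸ K)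
  -- The quotient consists of left cosets; inverting y turns right K-invariance into left.
  refine ⟨fun n => (fun y : 𝒢 => ((y⁻¹ : 𝒢) : 𝒢 ⧸ K)) ⁻¹' O n, fun n => ?_, fun n => ?_,
    fun n k hk y => ?_, fun m n hmn => ?_⟩
  · obtain ⟨q, hq⟩ := (hO n).nonempty
    obtain ⟨y, rfl⟩ := QuotientGroup.mk_surjective q
    exact ⟨y⁻¹, by simpa using hq⟩
  · exact (hOo n).preimage (QuotientGroup.continuous_mk.comp continuous_inv)
  · have : (((k * y)⁻¹ : 𝒢) : 𝒢 ⧸ K) = ((y⁻¹ : 𝒢) : 𝒢 ⧸ K) :=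
      QuotientGroup.eq.2 (by simpa using hk)
    simp only [Set.mem_preimage, this]
  · exact (hOd hmn).preimage _

end UnitaryRep

theorem exists_continuous_bump_of_mem_nhds {X : Type*} [TopologicalSpace X] [RegularSpace X]
    [LocallyCompactSpace X] {s : X} {W : Set X} (hW : W ∈ nhds s) :
    ∃ φ : X → ℝ, Continuous φ ∧ HasCompactSupport φ ∧ (∀ y, 0 ≤ φ y) ∧ (∀ y, φ y ≤ 1) ∧
      φ s = 1 ∧ ∀ y, φ y ≠ 0 → y ∈ W := by
  obtain ⟨φ, h1, h0, hs, h01⟩ := exists_continuous_one_zero_of_isCompact (s := {s})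
    (t := (interior W)ᶜ) isCompact_singleton isOpen_interior.isClosed_compl
    (Set.disjoint_singleton_left.2 fun h => h (mem_interior_iff_mem_nhds.2 hW))
  refine ⟨φ, φ.continuous, hs, fun y => (h01 y).1, fun y => (h01 y).2, h1 rfl, fun y hy => ?_⟩
  by_contra hyW
  exact hy (h0 fun h => hyW (interior_subset h))

namespace UnitaryRep

variable {G : Type*} [Group G] [TopologicalSpace G] [IsTopologicalGroup G]
  [LocallyCompactSpace G] [SecondCountableTopology G]
  [MeasurableSpace G] [BorelSpace G] {μ : Measure G} [μ.IsHaarMeasure]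
  {H : Type*} [NormedAddCommGroup H] [InnerProductSpace ℂ H]
  {π : UnitaryRep G H} {I : Type*} {u : I → H}
  {𝒢 : Type*} [Group 𝒢] [TopologicalSpace 𝒢] [IsTopologicalGroup 𝒢]
  [LocallyCompactSpace 𝒢] [SecondCountableTopology 𝒢] [T2Space 𝒢]
  [MeasurableSpace 𝒢] [BorelSpace 𝒢] {ν : Measure 𝒢} [ν.IsHaarMeasure] {ι : G →ₜ* 𝒢}

-- After multiplication by a, the real part of the integrand is continuous, nonnegative and positive
-- at x = 1.
omit [IsTopologicalGroup G] [LocallyCompactSpace G] [SecondCountableTopology G]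
  [LocallyCompactSpace 𝒢] [SecondCountableTopology 𝒢] [T2Space 𝒢]
  [MeasurableSpace 𝒢] [BorelSpace 𝒢] in
theorem integral_bump_mul_ne_zero (hι : Topology.IsClosedEmbedding ι) {φ : 𝒢 → ℝ}
    (hφ : Continuous φ) (hφs : HasCompactSupport φ) (hφ0 : ∀ y, 0 ≤ φ y) {s : 𝒢} (hs : φ s ≠ 0)
    {c : G → ℂ} (hc : Continuous c) {a : ℂ}
    (hac : ∀ x, φ ((ι x)⁻¹ * s) ≠ 0 → 0 < (a * c x).re) :
    ∫ x, (φ ((ι x)⁻¹ * s) : ℂ) * c x ∂μ ≠ 0 := by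
  intro h0
  have hιc : Continuous ι := hι.continuous
  have hint := (integrable_convolution_integrand (μ := μ) hι hφ hφs hc s).const_mul a
  have hre : ∀ x, (a * ((φ ((ι x)⁻¹ * s) : ℂ) * c x)).re = φ ((ι x)⁻¹ * s) * (a * c x).re :=
    fun x => by rw [mul_left_comm, Complex.re_ofReal_mul]
  have hint' : Integrable (fun x => φ ((ι x)⁻¹ * s) * (a * c x).re) μ := by
    refine hint.re.congr (Filter.Eventually.of_forall hre)
  have hzero : ∫ x, φ ((ι x)⁻¹ * s) * (a * c x).re ∂μ = 0 := by
    calc _ = ∫ x, RCLike.re (a * ((φ ((ι x)⁻¹ * s) : ℂ) * c x)) ∂μ :=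
          integral_congr_ae (Filter.Eventually.of_forall fun x => (hre x).symm)
      _ = RCLike.re (∫ x, a * ((φ ((ι x)⁻¹ * s) : ℂ) * c x) ∂μ) := integral_re hint
      _ = 0 := by rw [integral_const_mul, h0, mul_zero, map_zero]
  have hnn : 0 ≤ fun x => φ ((ι x)⁻¹ * s) * (a * c x).re := fun x => by
    by_cases hx : φ ((ι x)⁻¹ * s) = 0
    · simp [hx]
    · exact mul_nonneg (hφ0 _) (hac x hx).le
  rw [integral_eq_zero_iff_of_nonneg hnn hint'] at hzero
  have hcont : Continuous fun x => φ ((ι x)⁻¹ * s) * (a * c x).re :=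
    (hφ.comp (hιc.inv.mul continuous_const)).mul
      (Complex.continuous_re.comp (continuous_const.mul hc))
  have h1 := congrFun ((hcont.ae_eq_iff_eq μ continuous_const).1 hzero) 1
  have hs1 : φ ((ι 1)⁻¹ * s) ≠ 0 := by rwa [map_one, inv_one, one_mul]
  exact (mul_ne_zero hs1 (hac 1 hs1).ne') h1

variable [CompleteSpace H]

theorem exists_intertwining_linearIsometry_of_infinite_index (hu : π.IsCompleteSystem u)
    (hB : π.IsBesselSystem μ u) [Countable I] (hι : Topology.IsClosedEmbedding ι)
    [Infinite (𝒢 ⧸ (ι : G →* 𝒢).range)] :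
    ∃ U : H →ₗᵢ[ℂ] Lp ℂ 2 ν, ∀ x v, U (π x v) = leftRegular ν (ι x) (U v) := by
  obtain ⟨B, hB, hBb⟩ := hB.exists_lintegral_le
  obtain ⟨A, hAne, hAo, hAinv, hAd⟩ :=
    Subgroup.exists_seq_isOpen_invariant_disjoint (ι : G →* 𝒢).range hι.isClosed_range
  obtain ⟨M, hM⟩ := (nhds (1 : 𝒢)).exists_antitone_basis
  obtain ⟨e, he⟩ := exists_injective_nat (I × ℕ)
  choose s hs using fun p : I × ℕ => hAne (e p)
  -- The first set separates the supports for different p; the second makes the bumps for (i, k)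
  -- concentrate around their centres as k grows.
  have hW : ∀ p, A (e p) ∩ (fun y => y * (s p)⁻¹) ⁻¹' M p.2 ∈ nhds (s p) := fun p => by
    refine Filter.inter_mem ((hAo _).mem_nhds (hs p)) ?_
    refine (continuous_mul_const (s p)⁻¹).continuousAt.preimage_mem_nhds ?_
    rw [mul_inv_cancel]
    exact hM.1.mem_of_mem trivial
  choose φ hφ hφs hφ0 hφ1 hφone hφW using fun p => exists_continuous_bump_of_mem_nhds (hW p)
  let F : I × ℕ → H → 𝒢 → ℂ := fun p v y =>
    ∫ x, (φ p ((ι x)⁻¹ * y) : ℂ) * inner ℂ (π x (u p.1)) v ∂μ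
  have hFint : ∀ p v y, Integrable
      (fun x => (φ p ((ι x)⁻¹ * y) : ℂ) * inner ℂ (π x (u p.1)) v) μ := fun p v y =>
    integrable_convolution_integrand hι (hφ p) (hφs p) (π.continuous_coefficient _ _) y
  have hFcont : ∀ p v, Continuous (F p v) := fun p v =>
    continuous_convolution hι (hφ p) (hφs p) (π.continuous_coefficient _ _)
  have hF0 : ∀ p v y, y ∉ A (e p) → F p v y = 0 := fun p v y hy => by
    refine integral_eq_zero_of_ae (Filter.Eventually.of_forall fun x => ?_)
    have : φ p ((ι x)⁻¹ * y) = 0 := by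
      by_contra h
      refine hy ((hAinv (e p) (ι x)⁻¹ ?_ y).1 (hφW p _ h).1)
      exact inv_mem ⟨x, rfl⟩
    simp [this]
  have hFtrans : ∀ p v g y, F p v (ι g * y) =
      ∫ x, (φ p ((ι x)⁻¹ * y) : ℂ) * inner ℂ (π (g * x) (u p.1)) v ∂μ := fun p v g y => by
    change ∫ x, _ ∂μ = _
    rw [← integral_mul_left_eq_self _ g]
    refine integral_congr_ae (Filter.Eventually.of_forall fun x => ?_)
    simp only [map_mul, mul_inv_rev, mul_assoc, inv_mul_cancel_left]
  refine exists_intertwining_linearIsometry π ν ι F (fun p v w y => ?_) (fun p c v y => ?_)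
    (fun p v => (hFcont p v).aestronglyMeasurable) (fun p => ?_) (fun p g v y => ?_)
    (fun p q hpq v y => ?_) (fun v hv => ?_)
  · change ∫ x, _ ∂μ = (∫ x, _ ∂μ) + ∫ x, _ ∂μ
    rw [← integral_add (hFint p v y) (hFint p w y)]
    simp only [inner_add_right, mul_add]
  · change ∫ x, _ ∂μ = c * ∫ x, _ ∂μ
    rw [← integral_const_mul]
    simp only [inner_smul_right, mul_left_comm]
  · obtain ⟨C, hC, hCe⟩ := exists_lintegral_convolution_le (μ := μ) (ν := ν) hι (hφ p) (hφs p)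
      fun y => by rw [Real.norm_of_nonneg (hφ0 p y)]; exact hφ1 p y
    refine ⟨C * B, ENNReal.mul_ne_top hC hB, fun v => ?_⟩
    rw [mul_assoc]
    exact (hCe _ (π.continuous_coefficient _ _)).trans (mul_le_mul_right (hBb p.1 v) C)
  · rw [← map_inv, hFtrans]
    simp only [F, coefficient_apply_right]
  · by_contra! h
    have hp := not_not.1 (mt (hF0 p v y) h.1)
    have hq := not_not.1 (mt (hF0 q v y) h.2)
    exact Set.disjoint_left.1 (hAd fun h => hpq (he h)) hp hq
  · by_contra hv0
    obtain ⟨g, i, hgi⟩ := exists_inner_ne_zero hu hv0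
    -- The value of F (i, k) v at ι(g)s averages c near 1, where c 1 ≠ 0. With a the conjugate of c
    -- 1, continuity gives Re(a c) > 0 near 1, so a large k excludes cancellation.
    let c : G → ℂ := fun x => inner ℂ (π (g * x) (u i)) v
    have hc : Continuous c := (π.continuous_coefficient _ _).comp (continuous_const_mul g)
    let a : ℂ := (starRingEnd ℂ) (c 1)
    have ha : 0 < (a * c 1).re := by
      have h1 : c 1 ≠ 0 := by simpa only [c, mul_one] using hgi
      rw [show a * c 1 = (Complex.normSq (c 1) : ℂ) from Complex.normSq_eq_conj_mul_self.symm,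
        Complex.ofReal_re]
      exact Complex.normSq_pos.2 h1
    have hnhds : {x | 0 < (a * c x⁻¹).re} ∈ nhds (1 : G) := by
      refine IsOpen.mem_nhds (isOpen_lt continuous_const (Complex.continuous_re.comp
        (continuous_const.mul (hc.comp continuous_inv)))) ?_
      change 0 < (a * c 1⁻¹).re
      rwa [inv_one]
    -- G carries the topology induced by ι, so some M k pulls back into this neighbourhood.
    rw [hι.isInducing.nhds_eq_comap, map_one] at hnhds
    obtain ⟨k, -, hk⟩ := (hM.1.comap ι).mem_iff.1 hnhds
    have hzero : F (i, k) v = fun _ => 0 :=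
      ((hFcont (i, k) v).ae_eq_iff_eq ν continuous_const).1 (hv (i, k))
    refine integral_bump_mul_ne_zero (μ := μ) hι (hφ (i, k)) (hφs (i, k)) (hφ0 (i, k))
      (s := s (i, k)) (by rw [hφone]; exact one_ne_zero) hc (a := a) (fun x hx => ?_)
      ((hFtrans (i, k) v g _).symm.trans (congrFun hzero _))
    have h2 : x⁻¹ ∈ ι ⁻¹' M k := by
      have h3 := (hφW (i, k) _ hx).2
      rw [Set.mem_preimage, mul_inv_cancel_right] at h3
      rwa [Set.mem_preimage, map_inv]
    have h4 : 0 < (a * c x⁻¹⁻¹).re := hk h2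
    rwa [inv_inv] at h4

end UnitaryRep

/-! ### The main theorem -/

theorem mainTheorem9
    {G : Type uG} [Group G] [TopologicalSpace G] [IsTopologicalGroup G]
    [LocallyCompactSpace G] [SecondCountableTopology G] [T2Space G]
    [MeasurableSpace G] [BorelSpace G]
    (μ : Measure G) [μ.IsHaarMeasure]
    {H : Type uH} [NormedAddCommGroup H] [InnerProductSpace ℂ H] [CompleteSpace H]
    [TopologicalSpace.SeparableSpace H]
    (π : UnitaryRep G H)
    {I : Type uI} [Countable I] (u : I → H)
    (hcomplete : π.IsCompleteSystem u) (hBessel : π.IsBesselSystem μ u)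
    {𝒢 : Type uS} [Group 𝒢] [TopologicalSpace 𝒢] [IsTopologicalGroup 𝒢]
    [LocallyCompactSpace 𝒢] [SecondCountableTopology 𝒢] [T2Space 𝒢]
    [MeasurableSpace 𝒢] [BorelSpace 𝒢]
    (ν : Measure 𝒢) [ν.IsHaarMeasure]
    (ι : G →ₜ* 𝒢) (hι : Topology.IsClosedEmbedding ι)
    (hindex : Cardinal.lift.{uS} (Cardinal.mk I) ≤
      Cardinal.lift.{uI} (Cardinal.mk (𝒢 ⧸ (ι : G →* 𝒢).range))) :
    ∃ V : Submodule ℂ (Lp ℂ 2 ν),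
      IsClosed (V : Set (Lp ℂ 2 ν)) ∧
      (∀ x : G, ∀ f ∈ V, leftRegular ν (ι x) f ∈ V) ∧
      ∃ U : H ≃ₗᵢ[ℂ] V,
        (∀ (x : G) (v : H), (U (π x v) : Lp ℂ 2 ν) = leftRegular ν (ι x) (U v)) ∧
        -- the system `E(u)` is equivalent to the system of translates generated by the `U (u i)`,
        -- which is complete in `V`
        (π.SystemsEquivalent u ((leftRegular ν).restrict ι) (fun i => (U (u i) : Lp ℂ 2 ν)) ∧
          ((leftRegular ν).restrict ι).orbitSpan (fun i => (U (u i) : Lp ℂ 2 ν)) = V) ∧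
        -- the same holds, with the same `V` and `U`, for every other complete Bessel system
        (∀ (J : Type uI) [Countable J] (w : J → H),
          π.IsCompleteSystem w → π.IsBesselSystem μ w →
          π.SystemsEquivalent w ((leftRegular ν).restrict ι) (fun j => (U (w j) : Lp ℂ 2 ν)) ∧
          ((leftRegular ν).restrict ι).orbitSpan (fun j => (U (w j) : Lp ℂ 2 ν)) = V) := by
  obtain ⟨U, hU⟩ : ∃ U : H →ₗᵢ[ℂ] Lp ℂ 2 ν, ∀ x v, U (π x v) = leftRegular ν (ι x) (U v) := by
    rcases finite_or_infinite (𝒢 ⧸ (ι : G →* 𝒢).range) with hfin | hinf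
    · have : (ι : G →* 𝒢).range.FiniteIndex := Subgroup.finiteIndex_of_finite_quotient
      -- The complement of a closed subgroup of finite index is a finite union of closed cosets.
      have hopen : IsOpen (Set.range ι) :=
        Subgroup.isOpen_of_isClosed_of_finiteIndex (ι : G →* 𝒢).range hι.isClosed_range
      obtain ⟨e⟩ := Cardinal.lift_mk_le'.1 hindex
      exact UnitaryRep.exists_intertwining_linearIsometry_of_isOpenEmbedding hcomplete hBessel
        ⟨hι.isEmbedding, hopen⟩ e e.injective
    · exact UnitaryRep.exists_intertwining_linearIsometry_of_infinite_index hcomplete hBessel hι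
  have hcl : IsClosed (Set.range U) := U.isometry.isClosedEmbedding.isClosed_range
  have key : ∀ (J : Type uI) (w : J → H), π.IsCompleteSystem w →
      π.SystemsEquivalent w ((leftRegular ν).restrict ι) (fun j => U (w j)) ∧
        ((leftRegular ν).restrict ι).orbitSpan (fun j => U (w j)) =
          LinearMap.range U.toLinearMap := fun J w hw =>
    ⟨π.systemsEquivalent_comp ((leftRegular ν).restrict ι) U hU w hw,
      π.orbitSpan_comp_eq_range ((leftRegular ν).restrict ι) U hU w hw⟩
  refine ⟨LinearMap.range U.toLinearMap, hcl, ?_, U.equivRange, hU, key I u hcomplete,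
    fun J _ w hw _ => key J w hw⟩
  rintro x _ ⟨v, rfl⟩
  exact ⟨π x v, hU x v⟩
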